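/- Let $G$ be a topological group, let $E$ be a (real or complex) Banach space, and let $\pi : G \to \mathcal{L}(E)$, $g \mapsto \pi_g$, be a representation of $G$ on $E$, that is, a homomorphism into the bounded linear operators on $E$ under composition, with $\pi_e = \mathrm{id}_E$, which is continuous for the weak operator topology on $\mathcal{L}(E)$. Let $\mathscr{S}$ be the closure of $\{\pi_g : g \in G\}$ in the weak operator topology, and put $$E_r = \{\xi \in E : \forall u \in \mathscr{S}\ \exists v \in \mathscr{S} \text{ with } vu\xi = \xi\}, \qquad E_{\mathrm{aws}} = \{\xi \in E : u\xi = 0 \text{ for some } u \in \mathscr{S}\}.$$ Suppose that $\pi$ is JdLG-admissible, that is, $\mathscr{S}$ is compact in the weak operator topology, and $E_r$ and $E_{\mathrm{aws}}$ are linear subspaces of $E$ with $E = E_r \oplus E_{\mathrm{aws}}$. Then $$E_r = \{\xi \in E : \pi(G)\xi \text{ is relatively compact in the norm topology of } E\}.$$ -/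

import Mathlib

namespace JdLG

/-- A (weakly continuous) representation of a topological monoid `S` on `E`: a monoid homomorphism
into the bounded operators on `E` that is continuous for the weak operator topology. -/
structure BanachRep (𝕜 S E : Type*) [RCLike 𝕜] [Monoid S] [TopologicalSpace S]
    [NormedAddCommGroup E] [NormedSpace 𝕜 E] extends S →* (E →L[𝕜] E) where
  weakly_continuous : Continuous fun s : S => ContinuousLinearMapWOT.ofCLM (toFun s)

variable {𝕜 E : Type*} [RCLike 𝕜] [NormedAddCommGroup E] [NormedSpace 𝕜 E]

/-- The closure `𝒮` of an operator semigroup `𝒯` in the weak operator topology. -/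
def weakClosure (𝒯 : Subsemigroup (E →L[𝕜] E)) : Set (E →WOT[𝕜] E) :=
  closure (ContinuousLinearMapWOT.ofCLM '' (𝒯 : Set (E →L[𝕜] E)))

/-- The reversible part `E_r` of `E` with respect to the operator semigroup `𝒯`. -/
def reversiblePart (𝒯 : Subsemigroup (E →L[𝕜] E)) : Set E :=
  {ξ | ∀ u ∈ weakClosure 𝒯, ∃ v ∈ weakClosure 𝒯, v (u ξ) = ξ}

/-- The almost weakly stable part `E_aws` of `E` with respect to the operator semigroup `𝒯`. -/
def awsPart (𝒯 : Subsemigroup (E →L[𝕜] E)) : Set E :=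
  {ξ | ∃ u ∈ weakClosure 𝒯, u ξ = 0}

/-- An operator semigroup is JdLG-admissible if it is relatively compact in the weak operator
topology and `E` is the direct sum of `E_r` and `E_aws`: both sets are linear subspaces, and these
subspaces are complementary. -/
structure IsAdmissible (𝒯 : Subsemigroup (E →L[𝕜] E)) : Prop where
  relatively_weakly_compact : IsCompact (weakClosure 𝒯)
  decomposition : ∃ R A : Submodule 𝕜 E,
    (R : Set E) = reversiblePart 𝒯 ∧ (A : Set E) = awsPart 𝒯 ∧ IsCompl R A

namespace BanachRep

variable {S : Type*} [Monoid S] [TopologicalSpace S]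

/-- The operator semigroup `{π_s | s ∈ S}` of a representation. -/
def operators (π : BanachRep 𝕜 S E) : Subsemigroup (E →L[𝕜] E) :=
  (MonoidHom.mrange π.toMonoidHom).toSubsemigroup

/-- The orbit `π(S)ξ` of a vector. -/
def orbit (π : BanachRep 𝕜 S E) (ξ : E) : Set E :=
  Set.range fun s : S => π.toMonoidHom s ξ

end BanachRep

end JdLG

/-!
Write `𝒮` for the weak closure of the operators of the representation. It is a semigroup, compact
and Hausdorff for the weak operator topology, with separately continuous multiplication, and it is
norm bounded by the uniform boundedness principle.

If the orbit of `ξ` is relatively norm compact and `u = lim π g` weakly along an ultrafilter, then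
`π g ξ → u ξ` in norm. With `v` the weak limit of `π g⁻¹` along the same ultrafilter, boundedness of
the group gives `π g⁻¹ (u ξ) → ξ` in norm, hence `v (u ξ) = ξ`
(`mem_reversiblePart_of_isCompact_closure_orbit`).

Conversely, let `ξ` be reversible. Since the reversible part is a linear subspace, idempotents of
`𝒮` act on it as the identity (`idempotent_apply_of_mem_reversiblePart`). Every compact
subsemigroup contains an idempotent (Ellis–Numakura), so a compact subsemigroup `T` of `𝒮` acts on
the reversible part as a group (`exists_leftInverse_on_reversiblePart`). To see that the orbit of
`ξ` is totally bounded one may consider one sequence in it at a time, and so replace `𝒮` by the weak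
closure `T` of a countable submonoid. Then `{u ξ | u ∈ T}` is weakly compact and norm separable. By
Baire's theorem it has a nonempty relatively weakly open subset of small norm diameter. The group
acts transitively, by weak homeomorphisms which are Lipschitz with a common constant, so all points
have such neighbourhoods and finitely many small balls cover the set
(`totallyBounded_orbit_of_isSeparable`). This replaces both Ellis' theorem on joint continuity and
the strong continuity of weakly continuous representations of compact groups.
-/

open Filter Set Topology

namespace JdLG

variable {𝕜 E : Type*} [RCLike 𝕜] [NormedAddCommGroup E] [NormedSpace 𝕜 E]

/-! ### The weak operator topology -/

theorem continuous_toWeakSpace_apply (ξ : E) :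
    Continuous fun u : E →WOT[𝕜] E => toWeakSpace 𝕜 E (u ξ) :=
  WeakBilin.continuous_of_continuous_eval _ fun f =>
    ContinuousLinearMapWOT.continuous_dual_apply ξ f

theorem continuous_mul_const_wot (v : E →WOT[𝕜] E) : Continuous fun u : E →WOT[𝕜] E => u * v :=
  ContinuousLinearMapWOT.continuous_of_dual_apply_continuous fun x f =>
    ContinuousLinearMapWOT.continuous_dual_apply (v x) f

theorem continuous_const_mul_wot (v : E →WOT[𝕜] E) : Continuous fun u : E →WOT[𝕜] E => v * u :=
  ContinuousLinearMapWOT.continuous_of_dual_apply_continuous fun x f =>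
    ContinuousLinearMapWOT.continuous_dual_apply x (f.comp v.toCLM)

theorem isClosed_toWeakSpace_image [NormedSpace ℝ E] [IsScalarTower ℝ 𝕜 E]
    {s : Set E} (hs : Convex ℝ s) (hc : IsClosed s) : IsClosed (toWeakSpace 𝕜 E '' s) := by
  rw [← hc.closure_eq, hs.toWeakSpace_closure 𝕜]
  exact isClosed_closure

theorem isClosed_toWeakSpace_closedBall (x : E) (r : ℝ) :
    IsClosed (toWeakSpace 𝕜 E '' Metric.closedBall x r) := by
  let : NormedSpace ℝ E := NormedSpace.restrictScalars ℝ 𝕜 E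
  have : IsScalarTower ℝ 𝕜 E := RestrictScalars.isScalarTower ℝ 𝕜 E
  exact isClosed_toWeakSpace_image (convex_closedBall x r) Metric.isClosed_closedBall

theorem isClosed_toWeakSpace_submodule {F : Submodule 𝕜 E} (hF : IsClosed (F : Set E)) :
    IsClosed (toWeakSpace 𝕜 E '' F) := by
  let : NormedSpace ℝ E := NormedSpace.restrictScalars ℝ 𝕜 E
  have : IsScalarTower ℝ 𝕜 E := RestrictScalars.isScalarTower ℝ 𝕜 E
  exact isClosed_toWeakSpace_image (F.restrictScalars ℝ).convex hF

/-- In a semigroup with separately continuous multiplication, the closure of a subsemigroup is a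
subsemigroup. -/
theorem mul_mem_closure_wot {A : Set (E →WOT[𝕜] E)} (hA : ∀ u ∈ A, ∀ v ∈ A, u * v ∈ A)
    {u v : E →WOT[𝕜] E} (hu : u ∈ closure A) (hv : v ∈ closure A) : u * v ∈ closure A := by
  have h : ∀ w ∈ A, w * v ∈ closure A := fun w hw =>
    map_mem_closure (continuous_const_mul_wot w) hv fun z hz => hA w hw z hz
  have := map_mem_closure (continuous_mul_const_wot v) hu h
  rwa [closure_closure] at this

theorem mul_mem_weakClosure {𝒯 : Subsemigroup (E →L[𝕜] E)} {u v : E →WOT[𝕜] E}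
    (hu : u ∈ weakClosure 𝒯) (hv : v ∈ weakClosure 𝒯) : u * v ∈ weakClosure 𝒯 := by
  refine mul_mem_closure_wot ?_ hu hv
  rintro _ ⟨a, ha, rfl⟩ _ ⟨b, hb, rfl⟩
  exact ⟨a * b, 𝒯.mul_mem ha hb, rfl⟩

/-- The uniform boundedness principle, applied first to the functionals on the dual given by the
vectors `u x`, then to the operators `u` themselves. -/
theorem exists_norm_le_of_isCompact_wot [CompleteSpace E] {K : Set (E →WOT[𝕜] E)}
    (hK : IsCompact K) : ∃ M : ℝ, 0 < M ∧ ∀ u ∈ K, ∀ x : E, ‖u x‖ ≤ M * ‖x‖ := by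
  have h1 : ∀ x : E, ∃ C, ∀ u : K, ‖u.1.toCLM x‖ ≤ C := by
    intro x
    obtain ⟨C, hC⟩ := banach_steinhaus
      (g := fun u : K => NormedSpace.inclusionInDoubleDual 𝕜 E (u.1 x)) fun f => by
        obtain ⟨C, hC⟩ := (hK.image
          (ContinuousLinearMapWOT.continuous_dual_apply x f)).isBounded.exists_norm_le
        exact ⟨C, fun u => hC _ ⟨u.1, u.2, rfl⟩⟩
    refine ⟨C, fun u => ?_⟩
    rw [← (NormedSpace.inclusionInDoubleDualLi (E := E) 𝕜).norm_map]
    exact hC u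
  obtain ⟨C, hC⟩ := banach_steinhaus h1
  refine ⟨max C 1, by positivity, fun u hu x => ?_⟩
  exact (u.toCLM.le_of_opNorm_le ((hC ⟨u, hu⟩).trans (le_max_left _ _)) x)

/-- A set is totally bounded as soon as every sequence in it has a totally bounded range. -/
theorem totallyBounded_of_forall_seq {X : Type*} [PseudoMetricSpace X] {s : Set X}
    (h : ∀ x : ℕ → X, (∀ n, x n ∈ s) → TotallyBounded (range x)) : TotallyBounded s := by
  rw [Metric.totallyBounded_iff]
  by_contra! hs
  obtain ⟨ε, hε, hs⟩ := hs
  obtain ⟨x, hxs, hx⟩ := exists_seq_of_forall_finset_exists (· ∈ s) (fun a b => ε ≤ dist b a)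
    fun t _ => by
      obtain ⟨y, hy, hyt⟩ := not_subset.1 (hs t t.finite_toSet)
      refine ⟨y, hy, fun z hz => ?_⟩
      by_contra! hlt
      exact hyt (mem_biUnion hz hlt)
  obtain ⟨t, ht, hxt⟩ := Metric.totallyBounded_iff.1 (h x hxs) (ε / 2) (half_pos hε)
  have hc : ∀ n, ∃ c ∈ t, dist (x n) c < ε / 2 := fun n => by
    simpa using hxt (mem_range_self n)
  choose c hct hc using hc
  obtain ⟨m, -, n, -, hmn, hcc⟩ :=
    infinite_univ.exists_lt_map_eq_of_mapsTo (f := c) (fun n _ => hct n) ht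
  have h1 := hc m
  rw [hcc] at h1
  linarith [hx m n hmn, dist_triangle_right (x n) (x m) (c n), hc n]

/-! ### Weakly compact orbits of groups of operators -/

/-- The fragmentation argument. Write `X = {u ξ | u ∈ T}`, a weakly compact set. Norm separability
and Baire's theorem give a nonempty relatively weakly open subset of `X` in a small norm ball; since
`T` acts transitively on `X`, with bounded inverses, every point of `X` has such a neighbourhood. -/
theorem totallyBounded_orbit_of_isSeparable {T : Set (E →WOT[𝕜] E)} (hT : IsCompact T)
    (hmul : ∀ u ∈ T, ∀ v ∈ T, u * v ∈ T) (hone : 1 ∈ T) {ξ : E}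
    (hinv : ∀ a ∈ T, ∃ b ∈ T, ∀ z ∈ T, b (a (z ξ)) = z ξ)
    {M : ℝ} (hM : 0 < M) (hbound : ∀ u ∈ T, ∀ x : E, ‖u x‖ ≤ M * ‖x‖)
    (hsep : TopologicalSpace.IsSeparable ((fun u : E →WOT[𝕜] E => u ξ) '' T)) :
    TotallyBounded ((fun u : E →WOT[𝕜] E => u ξ) '' T) := by
  rw [Metric.totallyBounded_iff]
  intro ε hε
  set X : Set (WeakSpace 𝕜 E) := (fun u : E →WOT[𝕜] E => toWeakSpace 𝕜 E (u ξ)) '' T with hX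
  have hXc : IsCompact X := hT.image (continuous_toWeakSpace_apply ξ)
  have : CompactSpace X := isCompact_iff_compactSpace.1 hXc
  have : Nonempty X := ⟨⟨_, 1, hone, rfl⟩⟩
  set δ : ℝ := ε / (2 * M) with hδ
  have hδ0 : 0 < δ := by positivity
  obtain ⟨c, hc, hcl⟩ := hsep
  have : Countable c := hc.to_subtype
  obtain ⟨x₀, O, hO, ⟨p, hpO⟩, hOx⟩ : ∃ x₀ : E, ∃ O : Set (WeakSpace 𝕜 E), IsOpen O ∧
      (∃ u₀ ∈ T, toWeakSpace 𝕜 E (u₀ ξ) ∈ O) ∧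
      ∀ u ∈ T, toWeakSpace 𝕜 E (u ξ) ∈ O → dist (u ξ) x₀ ≤ δ := by
    -- Closed balls are weakly closed, so Baire's theorem applies in the compact space `X`.
    obtain ⟨i, ⟨q, hqT⟩, hq⟩ := nonempty_interior_of_iUnion_of_closed (X := X)
      (f := fun x : c => Subtype.val ⁻¹' (toWeakSpace 𝕜 E '' Metric.closedBall (x : E) δ))
      (fun x => (isClosed_toWeakSpace_closedBall (𝕜 := 𝕜) (x : E) δ).preimage
        continuous_subtype_val) (by
        refine eq_univ_of_forall ?_
        rintro ⟨_, u, hu, rfl⟩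
        obtain ⟨y, hy, hyd⟩ := Metric.mem_closure_iff.1 (hcl ⟨u, hu, rfl⟩) δ hδ0
        exact mem_iUnion.2 ⟨⟨y, hy⟩, u ξ, Metric.mem_closedBall.2 hyd.le, rfl⟩)
    obtain ⟨V, ⟨hVo, hVsub⟩, hqV⟩ := hq
    obtain ⟨O, hO, rfl⟩ := isOpen_induced_iff.1 hVo
    obtain ⟨u₀, hu₀, rfl⟩ := hqT
    refine ⟨i, O, hO, ⟨u₀, hu₀, hqV⟩, fun u hu huO => ?_⟩
    obtain ⟨y, hy, hyu⟩ := hVsub (show (⟨_, u, hu, rfl⟩ : X) ∈ _ from huO)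
    rw [← (toWeakSpace 𝕜 E).injective hyu]
    exact hy
  obtain ⟨hu₀, hpO⟩ := hpO
  have hloc : ∀ w ∈ T, ∃ W : Set (E →WOT[𝕜] E), ∃ y : E, IsOpen W ∧ w ∈ W ∧
      ∀ u ∈ T, u ∈ W → dist (u ξ) y < ε := by
    intro w hw
    obtain ⟨v, hv, hvw⟩ := hinv w hw
    have ha := hmul p hu₀ v hv
    obtain ⟨b, hb, hba⟩ := hinv _ ha
    -- `p * v` carries `w ξ` to the point `p ξ` of `O`, and `b` undoes it at the cost of a factor `M`.
    refine ⟨(fun u => toWeakSpace 𝕜 E ((p * v * u) ξ)) ⁻¹' O, b x₀,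
      hO.preimage ((continuous_toWeakSpace_apply ξ).comp (continuous_const_mul_wot _)), ?_, ?_⟩
    · have h1 : v (w ξ) = ξ := hvw 1 hone
      show toWeakSpace 𝕜 E (p (v (w ξ))) ∈ O
      rwa [h1]
    · intro u hu huO
      have h1 := hOx _ (hmul _ ha u hu) huO
      calc dist (u ξ) (b x₀) = ‖b ((p * v * u) ξ - x₀)‖ := by
            rw [dist_eq_norm, map_sub]
            exact congrArg (fun z => ‖z - b x₀‖) (hba u hu).symm
        _ ≤ M * ‖(p * v * u) ξ - x₀‖ := hbound b hb _
        _ ≤ M * δ := by rw [← dist_eq_norm]; gcongr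
        _ = ε / 2 := by rw [hδ]; field_simp
        _ < ε := half_lt_self hε
  choose! W y hW hwW hWy using hloc
  obtain ⟨t, ht⟩ := hT.elim_nhds_subcover' (fun w _ => W w)
    (fun w hw => (hW w hw).mem_nhds (hwW w hw))
  refine ⟨(fun w : T => y w) '' t, t.finite_toSet.image _, ?_⟩
  rintro _ ⟨u, hu, rfl⟩
  obtain ⟨w, hw, huw⟩ := mem_iUnion₂.1 (ht hu)
  exact mem_biUnion (mem_image_of_mem _ hw) (hWy w w.2 u hu huw)

/-- The reversible part is invariant: if `v` undoes `u * w` on `ξ`, then `w * v` undoes `u` on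
`w ξ`. -/
theorem apply_mem_reversiblePart {𝒯 : Subsemigroup (E →L[𝕜] E)} {ξ : E}
    (hξ : ξ ∈ reversiblePart 𝒯) {w : E →WOT[𝕜] E} (hw : w ∈ weakClosure 𝒯) :
    w ξ ∈ reversiblePart 𝒯 := by
  intro u hu
  obtain ⟨v, hv, hvξ⟩ := hξ _ (mul_mem_weakClosure hu hw)
  exact ⟨w * v, mul_mem_weakClosure hw hv, congrArg w hvξ⟩

/-- An idempotent `e` kills `e ξ - ξ`, which is a reversible vector, hence zero. -/
theorem idempotent_apply_of_mem_reversiblePart {𝒯 : Subsemigroup (E →L[𝕜] E)}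
    {R : Submodule 𝕜 E} (hR : (R : Set E) = reversiblePart 𝒯) {e : E →WOT[𝕜] E}
    (he : e ∈ weakClosure 𝒯) (hee : e * e = e) {ξ : E} (hξ : ξ ∈ reversiblePart 𝒯) :
    e ξ = ξ := by
  have h1 : e ξ - ξ ∈ reversiblePart 𝒯 := by
    have h2 := apply_mem_reversiblePart hξ he
    rw [← hR] at hξ h2 ⊢
    exact R.sub_mem h2 hξ
  obtain ⟨v, -, hv⟩ := h1 e he
  have h3 : e (e ξ) = e ξ := DFunLike.congr_fun hee ξ
  rw [map_sub, h3, sub_self, map_zero] at hv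
  exact sub_eq_zero.1 hv.symm

/-- Inside any compact subsemigroup `T` of `𝒮`, each operator is invertible from the left on the
reversible part: the compact left ideal `T * a` contains an idempotent. -/
theorem exists_leftInverse_on_reversiblePart {𝒯 : Subsemigroup (E →L[𝕜] E)}
    {R : Submodule 𝕜 E} (hR : (R : Set E) = reversiblePart 𝒯) {T : Set (E →WOT[𝕜] E)}
    (hT : IsCompact T) (hTS : T ⊆ weakClosure 𝒯) (hmul : ∀ u ∈ T, ∀ v ∈ T, u * v ∈ T)
    {a : E →WOT[𝕜] E} (ha : a ∈ T) :
    ∃ b ∈ T, ∀ η ∈ reversiblePart 𝒯, b (a η) = η := by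
  obtain ⟨_, ⟨b, hb, rfl⟩, hidem⟩ := exists_idempotent_in_compact_subsemigroup
    continuous_mul_const_wot ((fun u => u * a) '' T) ⟨_, a, ha, rfl⟩
    (hT.image (continuous_mul_const_wot a)) (by
      rintro _ ⟨u, hu, rfl⟩ _ ⟨v, hv, rfl⟩
      exact ⟨u * a * v, hmul _ (hmul u hu a ha) v hv, by simp only [mul_assoc]⟩)
  exact ⟨b, hb, fun η hη => idempotent_apply_of_mem_reversiblePart hR
    (hTS (hmul b hb a ha)) hidem hη⟩

/-- The orbit of `ξ` under the weak closure of a countable set of operators stays in a norm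
separable closed subspace, because closed subspaces are weakly closed. -/
theorem isSeparable_closure_wot_orbit {N : Set (E →L[𝕜] E)} (hN : N.Countable) (ξ : E) :
    TopologicalSpace.IsSeparable
      ((fun u : E →WOT[𝕜] E => u ξ) '' closure (ContinuousLinearMapWOT.ofCLM '' N)) := by
  set F : Submodule 𝕜 E := (Submodule.span 𝕜 ((fun u : E →L[𝕜] E => u ξ) '' N)).topologicalClosure
  have hF : TopologicalSpace.IsSeparable (F : Set E) := by
    rw [Submodule.topologicalClosure_coe]
    exact ((hN.image _).isSeparable.span (R := 𝕜)).closure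
  refine hF.mono ?_
  have hsub : closure (ContinuousLinearMapWOT.ofCLM '' N) ⊆
      (fun u : E →WOT[𝕜] E => toWeakSpace 𝕜 E (u ξ)) ⁻¹' (toWeakSpace 𝕜 E '' F) := by
    refine closure_minimal ?_ ((isClosed_toWeakSpace_submodule
      (Submodule.isClosed_topologicalClosure _)).preimage (continuous_toWeakSpace_apply ξ))
    rintro _ ⟨u, hu, rfl⟩
    exact ⟨u ξ, Submodule.le_topologicalClosure _ (Submodule.subset_span ⟨u, hu, rfl⟩), rfl⟩
  rintro _ ⟨u, hu, rfl⟩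
  obtain ⟨y, hy, hyu⟩ := hsub hu
  rwa [(toWeakSpace 𝕜 E).injective hyu] at hy

/-- Total boundedness only concerns sequences, so it suffices to consider the compact semigroups
generated by countably many of the operators. -/
theorem totallyBounded_orbit_of_mem_reversiblePart [CompleteSpace E] {S : Type*} [Monoid S]
    [TopologicalSpace S] {π : BanachRep 𝕜 S E} (hc : IsCompact (weakClosure π.operators))
    {R : Submodule 𝕜 E} (hR : (R : Set E) = reversiblePart π.operators) {ξ : E}
    (hξ : ξ ∈ reversiblePart π.operators) : TotallyBounded (π.orbit ξ) := by
  refine totallyBounded_of_forall_seq fun x hx => ?_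
  choose g hg using hx
  obtain ⟨M, hM, hbound⟩ := exists_norm_le_of_isCompact_wot hc
  set N : Submonoid (E →L[𝕜] E) := MonoidHom.mrange (π.toMonoidHom.comp (FreeMonoid.lift g)) with hN
  have hNc : (N : Set (E →L[𝕜] E)).Countable := by
    have : Countable (FreeMonoid ℕ) := inferInstanceAs (Countable (List ℕ))
    rw [hN, MonoidHom.coe_mrange]
    exact countable_range _
  set T : Set (E →WOT[𝕜] E) := closure (ContinuousLinearMapWOT.ofCLM '' (N : Set (E →L[𝕜] E)))
  have hTS : T ⊆ weakClosure π.operators := by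
    refine closure_mono (image_mono ?_)
    rintro _ ⟨m, rfl⟩
    exact ⟨FreeMonoid.lift g m, rfl⟩
  have hT : IsCompact T := hc.of_isClosed_subset isClosed_closure hTS
  have hmul : ∀ u ∈ T, ∀ v ∈ T, u * v ∈ T := fun u hu v hv =>
    mul_mem_weakClosure (𝒯 := N.toSubsemigroup) hu hv
  have hone : (1 : E →WOT[𝕜] E) ∈ T := subset_closure ⟨1, N.one_mem, rfl⟩
  refine (totallyBounded_orbit_of_isSeparable hT hmul hone (fun a ha => ?_) hM
    (fun u hu => hbound u (hTS hu)) (isSeparable_closure_wot_orbit hNc ξ)).subset ?_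
  · obtain ⟨b, hb, hba⟩ := exists_leftInverse_on_reversiblePart hR hT hTS hmul ha
    exact ⟨b, hb, fun z hz => hba _ (apply_mem_reversiblePart hξ (hTS hz))⟩
  · rintro _ ⟨n, rfl⟩
    refine ⟨ContinuousLinearMapWOT.ofCLM (π.toMonoidHom (g n)), subset_closure ⟨_, ?_, rfl⟩, hg n⟩
    exact ⟨FreeMonoid.of n, by simp⟩

/-! ### Vectors with relatively compact orbit -/

/-- If `u` is the weak limit of `π g` along an ultrafilter, then `π g ξ` converges to `u ξ` in norm,
and a weak limit `v` of `π g⁻¹` along the same ultrafilter satisfies `v (u ξ) = ξ`. -/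
theorem mem_reversiblePart_of_isCompact_closure_orbit [CompleteSpace E] {G : Type*} [Group G]
    [TopologicalSpace G] {π : BanachRep 𝕜 G E} (hc : IsCompact (weakClosure π.operators)) {ξ : E}
    (hξ : IsCompact (closure (π.orbit ξ))) : ξ ∈ reversiblePart π.operators := by
  obtain ⟨M, hM, hbound⟩ := exists_norm_le_of_isCompact_wot hc
  set ρ : G → E →WOT[𝕜] E := fun g => ContinuousLinearMapWOT.ofCLM (π.toMonoidHom g) with hρ
  have hρS : ∀ g, ρ g ∈ weakClosure π.operators := fun g => subset_closure ⟨_, ⟨g, rfl⟩, rfl⟩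
  intro u hu
  have hu' : u ∈ closure (range ρ) := by
    refine closure_mono ?_ hu
    rintro _ ⟨_, ⟨g, rfl⟩, rfl⟩
    exact ⟨g, rfl⟩
  have hne : (comap ρ (𝓝 u)).NeBot := comap_neBot_iff.2 fun t ht => by
    obtain ⟨_, h, g, rfl⟩ := mem_closure_iff_nhds.1 hu' t ht
    exact ⟨g, h⟩
  set 𝓤 : Ultrafilter G := Ultrafilter.of (comap ρ (𝓝 u))
  have hlim : Tendsto ρ 𝓤 (𝓝 u) := tendsto_comap.mono_left (Ultrafilter.of_le _)
  have hweak : ∀ f : StrongDual 𝕜 E, ∀ x, Tendsto (fun g => f (ρ g x)) 𝓤 (𝓝 (f (u x))) :=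
    fun f x => ContinuousLinearMapWOT.tendsto_iff_forall_dual_apply_tendsto.1 hlim x f
  have hnorm : Tendsto (fun g => ρ g ξ) 𝓤 (𝓝 (u ξ)) := by
    obtain ⟨η, -, hη⟩ := hξ.ultrafilter_le_nhds (𝓤.map fun g => ρ g ξ)
      (le_principal_iff.2 (Ultrafilter.mem_map.2 (univ_mem' fun g => subset_closure ⟨g, rfl⟩)))
    have hη' : Tendsto (fun g => ρ g ξ) 𝓤 (𝓝 η) := hη
    have : η = u ξ := by
      refine SeparatingDual.eq_iff_forall_dual_eq (R := 𝕜) |>.2 fun f => ?_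
      exact tendsto_nhds_unique ((f.continuous.tendsto η).comp hη') (hweak f ξ)
    rwa [this] at hη'
  obtain ⟨v, hv, hvlim⟩ := hc.ultrafilter_le_nhds (𝓤.map fun g => ρ g⁻¹)
    (le_principal_iff.2 (Ultrafilter.mem_map.2 (univ_mem' fun g => hρS g⁻¹)))
  have hvlim' : Tendsto (fun g => ρ g⁻¹) 𝓤 (𝓝 v) := hvlim
  have hinv : Tendsto (fun g => ρ g⁻¹ (u ξ)) 𝓤 (𝓝 ξ) := by
    rw [tendsto_iff_norm_sub_tendsto_zero]
    have h0 : Tendsto (fun g => M * ‖ρ g ξ - u ξ‖) 𝓤 (𝓝 0) := by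
      simpa using (tendsto_iff_norm_sub_tendsto_zero.1 hnorm).const_mul M
    refine squeeze_zero (fun _ => norm_nonneg _) (fun g => ?_) h0
    have h1 : ρ g⁻¹ (ρ g ξ) = ξ := by
      have h2 : π.toMonoidHom g⁻¹ * π.toMonoidHom g = 1 := by rw [← map_mul, inv_mul_cancel, map_one]
      exact DFunLike.congr_fun h2 ξ
    calc ‖ρ g⁻¹ (u ξ) - ξ‖ = ‖ρ g⁻¹ (u ξ - ρ g ξ)‖ := by rw [map_sub, h1]
      _ ≤ M * ‖u ξ - ρ g ξ‖ := hbound _ (hρS _) _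
      _ = M * ‖ρ g ξ - u ξ‖ := by rw [norm_sub_rev]
  refine ⟨v, hv, SeparatingDual.eq_iff_forall_dual_eq (R := 𝕜) |>.2 fun f => ?_⟩
  exact tendsto_nhds_unique
    (ContinuousLinearMapWOT.tendsto_iff_forall_dual_apply_tendsto.1 hvlim' (u ξ) f)
    ((f.continuous.tendsto ξ).comp hinv)

end JdLG

theorem mainTheorem7 {𝕜 G E : Type*} [RCLike 𝕜]
    [Group G] [TopologicalSpace G] [IsTopologicalGroup G]
    [NormedAddCommGroup E] [NormedSpace 𝕜 E] [CompleteSpace E]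
    (π : JdLG.BanachRep 𝕜 G E) (hπ : JdLG.IsAdmissible π.operators) :
    JdLG.reversiblePart π.operators = {ξ : E | IsCompact (closure (π.orbit ξ))} := by
  obtain ⟨R, -, hR, -, -⟩ := hπ.decomposition
  refine Set.Subset.antisymm (fun ξ hξ => ?_) fun ξ hξ =>
    JdLG.mem_reversiblePart_of_isCompact_closure_orbit hπ.relatively_weakly_compact hξ
  exact isCompact_iff_totallyBounded_isComplete.2
    ⟨(JdLG.totallyBounded_orbit_of_mem_reversiblePart hπ.relatively_weakly_compact hR hξ).closure,
      isClosed_closure.isComplete⟩
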